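/- Let $n,t$ be integers with $t\ge 1$ and $n\ge 2t+1$, and let $f=(0,t)_n$ be the Boolean function $GF(2)^n\to GF(2)$ given by $$f(x_0,\dots,x_{n-1})=\sum_{i=0}^{n-1}x_i\,x_{i+t}\qquad(\text{indices mod } n).$$ Let $\nu(t)$ be the largest $c$ with $2^c\mid t$, let $wt(f)$ be the number of ones of $f$ ($f$ is balanced if it takes the values $0$ and $1$ equally often), let $N(f)$ be the minimum Hamming distance from $f$ to an affine function, and let $W_f(w)=\sum_x(-1)^{f(x)+w\cdot x}$ be its Walsh transform. For an integer $v\ge 0$, $f$ is called $v$-plateaued if every Walsh value is $0$ or $\pm 2^{(n+v)/2}$; such a $v$, called the $v$-value of $f$, is denoted $v(n)$. An integer $d\ge 0$ is a Dickson rank of $f$ if $f$ is affine equivalent (under invertible affine changes of variables of $GF(2)^n$) to $y_1y_2+\dots+y_{2d-1}y_{2d}+y_{2d+1}$ with $2d+1\le n$ when $f$ is balanced, and to $y_1y_2+\dots+y_{2d-1}y_{2d}+b$ with $2d\le n$ and $b\in GF(2)$ when $f$ is not balanced. Then: 1. $f$ is not balanced if and only if $n\equiv 0 \pmod{2^{\nu(t)+1}}$.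 2. $f$ has exactly one $v$-value, namely $v(n)=\gcd(n,2t)$, and exactly one Dickson rank $d$. 3. Put $k=\gcd(n,t)$. If $f$ is balanced, then $v(n)=k$, $wt(f)=2^{n-1}$, $N(f)=2^{n-1}-2^{(n+k)/2-1}$ and $d=(n-k)/2$. 4. If $f$ is not balanced, then $v(n)=2k$, $wt(f)=N(f)=2^{n-1}-2^{n/2+k-1}$ and $d=n/2-k$. -/

import Mathlib

/-- Boolean functions in `n` variables `x_0, …, x_{n-1}`: maps from `GF(2)^n` to `GF(2)`. -/
abbrev BoolFun (n : ℕ) : Type := (Fin n → ZMod 2) → ZMod 2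

namespace BoolFun

variable {n : ℕ}

/-- The function `(0,t)_n = x_0 x_t + x_1 x_{t+1} + ⋯ + x_{n-1} x_{t-1}`, with indices modulo `n`.
For `1 ≤ t` and `2t + 1 ≤ n` the `n` monomials are distinct, so this is the monomial rotation
symmetric function generated by `x_0 x_t`. -/
def mrs (n t : ℕ) : BoolFun n :=
  fun x => ∑ i : Fin n, x i * x ⟨((i : ℕ) + t) % n, Nat.mod_lt _ i.pos⟩

/-- The (Hamming) weight: the number of ones in the truth table. -/
def wt (f : BoolFun n) : ℕ := (Finset.univ.filter fun x => f x = 1).card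

/-- A function is balanced if its truth table has as many zeros as ones. -/
def IsBalanced (f : BoolFun n) : Prop :=
  (Finset.univ.filter fun x => f x = 0).card = (Finset.univ.filter fun x => f x = 1).card

/-- Affine functions: those of degree at most one. -/
def IsAffine (g : BoolFun n) : Prop :=
  ∃ (a : Fin n → ZMod 2) (b : ZMod 2), ∀ x, g x = ∑ i, a i * x i + b

/-- The nonlinearity: the minimum Hamming distance to an affine function. -/
noncomputable def nonlinearity (f : BoolFun n) : ℕ :=
  sInf {m : ℕ | ∃ g : BoolFun n, IsAffine g ∧ hammingDist f g = m}

/-- The Walsh transform `W_f(w) = ∑_x (-1)^{f(x) + w ⬝ x}`. -/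
noncomputable def walsh (f : BoolFun n) (w : Fin n → ZMod 2) : ℝ :=
  ∑ x : Fin n → ZMod 2, (-1 : ℝ) ^ (f x + ∑ i, w i * x i).val

/-- `f` is `v`-plateaued: every Walsh value is `0` or `±2^{(n+v)/2}`. -/
def IsVPlateaued (f : BoolFun n) (v : ℕ) : Prop :=
  ∀ w, walsh f w = 0 ∨ walsh f w = (2 : ℝ) ^ (((n : ℝ) + v) / 2) ∨
    walsh f w = -(2 : ℝ) ^ (((n : ℝ) + v) / 2)

/-- Affine equivalence: `f x = g (A x + b)` with `A` an invertible matrix over `GF(2)`. -/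
def AffineEquivalent (f g : BoolFun n) : Prop :=
  ∃ (A : Matrix (Fin n) (Fin n) (ZMod 2)) (b : Fin n → ZMod 2),
    IsUnit A ∧ ∀ x, f x = g (A.mulVec x + b)

/-- The function `x_0 x_1 + x_2 x_3 + ⋯ + x_{2d-2} x_{2d-1}` in `n ≥ 2d` variables. -/
def hyperbolicSum {d : ℕ} (h : 2 * d ≤ n) : BoolFun n :=
  fun x => ∑ i : Fin d, x ⟨2 * (i : ℕ), by omega⟩ * x ⟨2 * (i : ℕ) + 1, by omega⟩

/-- `d` is a Dickson rank of `f`: a balanced `f` is affine equivalent to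
`x_0 x_1 + ⋯ + x_{2d-2} x_{2d-1} + x_{2d}`, and an unbalanced `f` is affine equivalent to
`x_0 x_1 + ⋯ + x_{2d-2} x_{2d-1} + b` for a constant `b`. -/
def IsDicksonRank (f : BoolFun n) (d : ℕ) : Prop :=
  (IsBalanced f ∧ ∃ h : 2 * d + 1 ≤ n,
    AffineEquivalent f fun x =>
      hyperbolicSum (Nat.le_of_succ_le h) x + x ⟨2 * d, h⟩) ∨
  (¬ IsBalanced f ∧ ∃ (h : 2 * d ≤ n) (b : ZMod 2),
    AffineEquivalent f fun x => hyperbolicSum h x + b)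

end BoolFun

/-!
The function `f = (0,t)_n` is quadratic: `f (x + y) = f x + f y + B x y` for the bilinear form
`B = mrsPolar n t`. Its radical consists of the `y` with `y_{i+2t} = y_i` (indices mod `n`), that is,
of the sequences of period `gcd (n, 2t)`, so it has `2 ^ gcd (n, 2t)` elements
(`card_ker_mrsPolar`).

Squaring the sum defining the Walsh transform gives
`W_f(w)^2 = 2^n * ∑_{y ∈ ker B} (-1)^{f y + w ⬝ y}` (`walsh_sq`). The exponent is additive on the
radical, so the sum is `0` or `|ker B|`, and `f` is plateaued with `v = gcd (n, 2t)`. Since the Walsh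
transform is not identically zero, the `v`-value is unique, and the nonlinearity is
`2^{n-1} - max |W_f| / 2`.

Balancedness means `W_f(0) = 0`. If the largest power of two `p` dividing `n` also divides `t`, the
indicator of the multiples of `p` lies in the radical and `f` takes the value `n / p`, which is odd,
on it, so `W_f(0) = 0` (`walsh_mrs_zero_eq_zero`). Otherwise `2^{ν(t)+1}` divides `n`, and the binary
digit of the index at position `ν(t)` makes the monomials `x_i x_{i+t}` the edges of a bipartite
graph. Then `f` pairs two complementary isotropic subspaces, and `W_f(0)` is the number of vectors
`B`-orthogonal to one of them, hence positive (`walsh_zero_pos_of_projection`). Knowing the sign of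
`W_f(0)` gives the weight.

The Dickson form exists for every quadratic function: splitting off the product of linear forms
`B(u, ·) B(v, ·)` with `B(u, v) = 1` enlarges the radical (`exists_hyperbolic_decomposition`), and the
remaining linear part is either absorbed by a translation or becomes a new coordinate. The rank `d`
is determined because the normal form has a Walsh value of modulus `2^{n-d}`, and every nonzero
value has modulus `2^{(n+v)/2}`, whence `2d + v = n`.
-/

namespace BoolFun

/-! ### Signs, the Walsh transform and plateaued functions -/

/-- The sign `(-1)^a` attached to `a : GF(2)`, as a real number. -/
noncomputable def sgn (a : ZMod 2) : ℝ := (-1 : ℝ) ^ a.val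

@[simp] lemma sgn_zero : sgn 0 = 1 := by simp [sgn]

@[simp] lemma sgn_one : sgn 1 = -1 := by simp [sgn, ZMod.val_one]

lemma zmod_two_cases (a : ZMod 2) : a = 0 ∨ a = 1 := by
  revert a; decide

lemma sgn_add (a b : ZMod 2) : sgn (a + b) = sgn a * sgn b := by
  rcases zmod_two_cases a with rfl | rfl <;> rcases zmod_two_cases b with rfl | rfl <;>
    simp [CharTwo.add_self_eq_zero]

lemma sgn_eq_one_or (a : ZMod 2) : sgn a = 1 ∨ sgn a = -1 := by
  rcases zmod_two_cases a with rfl | rfl <;> simp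

lemma sgn_mul_self (a : ZMod 2) : sgn a * sgn a = 1 := by
  rcases sgn_eq_one_or a with h | h <;> rw [h] <;> norm_num

/-- A sum of signs vanishes when some translation flips every sign. -/
lemma sum_sgn_eq_zero {G : Type*} [AddGroup G] [Fintype G] (g : G → ZMod 2) (e : G)
    (h : ∀ x, g (x + e) = g x + 1) : ∑ x, sgn (g x) = 0 := by
  have h1 := Equiv.sum_comp (Equiv.addRight e) fun x => sgn (g x)
  simp only [Equiv.coe_addRight, h, sgn_add, sgn_one, mul_neg, mul_one,
    Finset.sum_neg_distrib] at h1
  linarith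

/-- Orthogonality: the sum of the signs of an additive `GF(2)`-valued function. -/
lemma sum_sgn_additive {G : Type*} [AddGroup G] [Fintype G] (g : G → ZMod 2)
    (h : ∀ x y, g (x + y) = g x + g y) [Decidable (∀ x, g x = 0)] :
    ∑ x, sgn (g x) = if ∀ x, g x = 0 then (Fintype.card G : ℝ) else 0 := by
  split_ifs with h0
  · simp [h0]
  · push Not at h0
    obtain ⟨e, he⟩ := h0
    refine sum_sgn_eq_zero g e fun x => ?_
    rw [h, (zmod_two_cases (g e)).resolve_left he]

variable {n : ℕ}

lemma walsh_eq_sum_sgn (f : BoolFun n) (w : Fin n → ZMod 2) :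
    walsh f w = ∑ x, sgn (f x + ∑ i, w i * x i) := rfl

lemma walsh_zero (f : BoolFun n) : walsh f 0 = ∑ x, sgn (f x) := by
  simp [walsh_eq_sum_sgn]

lemma card_cube : Fintype.card (Fin n → ZMod 2) = 2 ^ n := by
  simp [ZMod.card]

/-- Counting zeros and ones of `h` recovers the sum of its signs. -/
lemma sum_sgn_eq_sub (h : BoolFun n) :
    ∑ x, sgn (h x) = (2 : ℝ) ^ n - 2 * ((Finset.univ.filter fun x => h x ≠ 0).card : ℝ) := by
  have h1 : ∀ x, sgn (h x) = 1 - 2 * (if h x ≠ 0 then (1 : ℝ) else 0) := by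
    intro x
    rcases zmod_two_cases (h x) with h0 | h0 <;> rw [h0] <;> norm_num
  simp only [h1, Finset.sum_sub_distrib, ← Finset.mul_sum, Finset.sum_boole]
  simp [ZMod.card]

lemma walsh_zero_eq_wt (f : BoolFun n) : walsh f 0 = (2 : ℝ) ^ n - 2 * (f.wt : ℝ) := by
  rw [walsh_zero, sum_sgn_eq_sub, wt]
  congr 4
  ext x
  rcases zmod_two_cases (f x) with h | h <;> simp [h]

lemma isBalanced_iff (f : BoolFun n) : f.IsBalanced ↔ walsh f 0 = 0 := by
  rw [walsh_zero_eq_wt, IsBalanced]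
  have h := Finset.card_filter_add_card_filter_not (s := (Finset.univ : Finset (Fin n → ZMod 2)))
    (fun x => f x = 0)
  have h2 : (Finset.univ.filter fun x => ¬ f x = 0) = Finset.univ.filter fun x => f x = 1 := by
    ext x
    rcases zmod_two_cases (f x) with h | h <;> simp [h]
  rw [h2, Finset.card_univ, card_cube] at h
  change _ + f.wt = _ at h
  change _ = f.wt ↔ _
  have h' : ((Finset.univ.filter fun x => f x = 0).card : ℝ) + f.wt = 2 ^ n := by exact_mod_cast h
  rw [← h']
  constructor
  · intro e; rw [e]; ring
  · intro e
    have : ((Finset.univ.filter fun x => f x = 0).card : ℝ) = f.wt := by linarith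
    exact_mod_cast this

lemma two_mul_hammingDist (f g : BoolFun n) (w : Fin n → ZMod 2) (b : ZMod 2)
    (hg : ∀ x, g x = ∑ i, w i * x i + b) :
    2 * (hammingDist f g : ℝ) = 2 ^ n - sgn b * walsh f w := by
  have h := sum_sgn_eq_sub fun x => f x + g x
  have h1 : ∑ x, sgn (f x + g x) = sgn b * walsh f w := by
    rw [walsh_eq_sum_sgn, Finset.mul_sum]
    refine Finset.sum_congr rfl fun x _ => ?_
    rw [hg, ← add_assoc, sgn_add _ b, mul_comm]
  have h2 : hammingDist f g = (Finset.univ.filter fun x => f x + g x ≠ 0).card := by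
    rw [hammingDist]
    congr 1
    ext x
    simp [CharTwo.add_eq_zero]
  rw [h2, ← h1, h]
  ring

/-- The Walsh transform of a Boolean function is not identically zero, by inversion at `0`. -/
lemma exists_walsh_ne_zero (f : BoolFun n) : ∃ w, walsh f w ≠ 0 := by
  classical
  by_contra! h
  have h1 : ∑ w, walsh f w = 2 ^ n * sgn (f 0) := by
    simp only [walsh_eq_sum_sgn]
    rw [Finset.sum_comm, Finset.sum_eq_single 0]
    · simp [ZMod.card]
    · intro x _ hx
      simp only [sgn_add, ← Finset.mul_sum]
      rw [sum_sgn_additive (fun w : Fin n → ZMod 2 => ∑ i, w i * x i)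
        (fun u v => by simp [add_mul, Finset.sum_add_distrib]), if_neg, mul_zero]
      intro h0
      refine hx (funext fun i => ?_)
      simpa [Pi.single_apply] using h0 (Pi.single i 1)
    · simp
  simp only [h, Finset.sum_const_zero] at h1
  rcases sgn_eq_one_or (f 0) with h2 | h2 <;> rw [h2] at h1 <;>
    nlinarith [show (0 : ℝ) < 2 ^ n by positivity]

/-- The nonzero absolute value `2^{(n+v)/2}` of a `v`-plateaued Walsh spectrum. -/
lemma IsVPlateaued.abs_walsh {f : BoolFun n} {v : ℕ} (h : f.IsVPlateaued v)
    {w : Fin n → ZMod 2} (hw : walsh f w ≠ 0) :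
    |walsh f w| = (2 : ℝ) ^ (((n : ℝ) + v) / 2) := by
  have h0 : (0 : ℝ) < (2 : ℝ) ^ (((n : ℝ) + v) / 2) := by positivity
  rcases h w with h | h | h
  · exact absurd h hw
  · rw [h, abs_of_pos h0]
  · rw [h, abs_neg, abs_of_pos h0]

lemma IsVPlateaued.unique {f : BoolFun n} {v v' : ℕ} (h : f.IsVPlateaued v)
    (h' : f.IsVPlateaued v') : v = v' := by
  obtain ⟨w, hw⟩ := exists_walsh_ne_zero f
  have h1 := (h.abs_walsh hw).symm.trans (h'.abs_walsh hw)
  have h2 := (Real.rpow_right_inj (by norm_num) (by norm_num)).1 h1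
  have : (v : ℝ) = v' := by linarith
  exact_mod_cast this

lemma IsVPlateaued.nonlinearity_eq {f : BoolFun n} {v : ℕ} (h : f.IsVPlateaued v) (hn : 1 ≤ n) :
    (f.nonlinearity : ℝ) = 2 ^ (n - 1) - (2 : ℝ) ^ (((n : ℝ) + v) / 2 - 1) := by
  have e1 : (2 : ℝ) ^ (((n : ℝ) + v) / 2 - 1) = (2 : ℝ) ^ (((n : ℝ) + v) / 2) / 2 := by
    rw [Real.rpow_sub (by norm_num), Real.rpow_one]
  have e2 : (2 : ℝ) ^ n = 2 * 2 ^ (n - 1) := by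
    rw [← pow_succ', Nat.sub_add_cancel hn]
  obtain ⟨w, hw⟩ := exists_walsh_ne_zero f
  have habs := h.abs_walsh hw
  set c := (2 : ℝ) ^ (((n : ℝ) + v) / 2)
  have hc : 0 < c := by positivity
  -- the sign `b` is chosen so that `w ⬝ x + b` agrees with `f` on the larger half
  obtain ⟨b, hb⟩ : ∃ b, sgn b * walsh f w = c := by
    rcases abs_choice (walsh f w) with h1 | h1
    · exact ⟨0, by rw [sgn_zero, one_mul, ← h1, habs]⟩
    · exact ⟨1, by rw [sgn_one, neg_one_mul, ← h1, habs]⟩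
  set S := {m : ℕ | ∃ g : BoolFun n, IsAffine g ∧ hammingDist f g = m}
  have hmem : hammingDist f (fun x => ∑ i, w i * x i + b) ∈ S := ⟨_, ⟨w, b, fun _ => rfl⟩, rfl⟩
  have hd := two_mul_hammingDist f _ w b fun _ => rfl
  rw [hb] at hd
  have hle : f.nonlinearity ≤ _ := Nat.sInf_le hmem
  have hge : 2 ^ n - c ≤ 2 * (f.nonlinearity : ℝ) := by
    obtain ⟨g, ⟨a, b', hg⟩, hg'⟩ : f.nonlinearity ∈ S := Nat.sInf_mem ⟨_, hmem⟩
    rw [← hg', two_mul_hammingDist f g a b' hg]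
    have h3 : sgn b' * walsh f a ≤ c := by
      rcases sgn_eq_one_or b' with h2 | h2 <;> rcases h a with h1 | h1 | h1 <;> rw [h1, h2] <;>
        linarith
    linarith
  have hle' : (f.nonlinearity : ℝ) ≤ hammingDist f (fun x => ∑ i, w i * x i + b) := by
    exact_mod_cast hle
  linarith

/-! ### Quadratic functions and the radical of their polar form -/

section Quadratic

variable {f : BoolFun n} {B : (Fin n → ZMod 2) →ₗ[ZMod 2] (Fin n → ZMod 2) →ₗ[ZMod 2] ZMod 2}

/-- Squaring the character sum leaves only the radical of the polar form. -/
lemma walsh_sq [Fintype (LinearMap.ker B)] (hB : ∀ x y, f (x + y) = f x + f y + B x y)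
    (w : Fin n → ZMod 2) :
    walsh f w ^ 2 =
      2 ^ n * ∑ y : LinearMap.ker B, sgn (f y + ∑ i, w i * (y : Fin n → ZMod 2) i) := by
  classical
  set F : BoolFun n := fun x => f x + ∑ i, w i * x i with hF
  have hFB : ∀ x y, F (x + y) = F x + (F y + B y x) := by
    intro x y
    have : ∑ i, w i * (x + y) i = ∑ i, w i * x i + ∑ i, w i * y i := by
      simp [mul_add, Finset.sum_add_distrib]
    simp only [hF]
    rw [this, add_comm x y, hB]
    ring
  have h1 : walsh f w ^ 2 = ∑ y, sgn (F y) * ∑ x, sgn (B y x) := by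
    change (∑ x, sgn (F x)) ^ 2 = _
    rw [sq, Finset.sum_mul_sum]
    have : ∀ x, ∑ y, sgn (F x) * sgn (F y) = ∑ y, sgn (F y) * sgn (B y x) := by
      intro x
      rw [← Equiv.sum_comp (Equiv.addLeft x)]
      refine Finset.sum_congr rfl fun y _ => ?_
      rw [Equiv.coe_addLeft, hFB, sgn_add (F x), sgn_add (F y), ← mul_assoc, sgn_mul_self, one_mul]
    simp only [this]
    rw [Finset.sum_comm]
    simp only [Finset.mul_sum]
  have h2 : ∀ y, ∑ x, sgn (B y x) = if y ∈ LinearMap.ker B then (2 : ℝ) ^ n else 0 := by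
    intro y
    rw [sum_sgn_additive _ fun u v => map_add (B y) u v, card_cube]
    have : (∀ x, B y x = 0) ↔ y ∈ LinearMap.ker B := by
      rw [LinearMap.mem_ker, LinearMap.ext_iff]; rfl
    simp [this]
  rw [h1]
  simp only [h2, mul_ite, mul_zero]
  rw [← Finset.sum_filter, Finset.mul_sum]
  rw [Finset.sum_subtype (p := fun y => y ∈ LinearMap.ker B) _ (by simp)]
  exact Finset.sum_congr rfl fun y _ => mul_comm _ _

lemma walsh_sq_cases (hB : ∀ x y, f (x + y) = f x + f y + B x y) (w : Fin n → ZMod 2) :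
    walsh f w = 0 ∨ walsh f w ^ 2 = 2 ^ n * Nat.card (LinearMap.ker B) := by
  classical
  have := Fintype.ofFinite (LinearMap.ker B)
  have h := walsh_sq hB w
  rw [sum_sgn_additive] at h
  · split_ifs at h
    · right; rw [h, Nat.card_eq_fintype_card]
    · left; simpa using h
  · intro x y
    have h0 : B x y = 0 := by rw [LinearMap.mem_ker.1 x.2]; rfl
    rw [Submodule.coe_add, hB, h0]
    simp [mul_add, Finset.sum_add_distrib]
    ring

/-- A quadratic function whose polar form has radical of size `2^v` is `v`-plateaued. -/
lemma isVPlateaued_of_card_ker (hB : ∀ x y, f (x + y) = f x + f y + B x y) {v : ℕ}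
    (hv : Nat.card (LinearMap.ker B) = 2 ^ v) : f.IsVPlateaued v := by
  intro w
  rcases walsh_sq_cases hB w with h | h
  · exact Or.inl h
  · right
    rw [← sq_eq_sq_iff_eq_or_eq_neg, h, hv, ← Real.rpow_natCast (_ ^ _) 2,
      ← Real.rpow_mul (by norm_num),
      show ((n : ℝ) + v) / 2 * (2 : ℕ) = ((n + v : ℕ) : ℝ) by push_cast; ring,
      Real.rpow_natCast, pow_add]
    push_cast
    rfl

lemma walsh_zero_eq_zero_of_mem_ker (hB : ∀ x y, f (x + y) = f x + f y + B x y)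
    {y : Fin n → ZMod 2} (hy : y ∈ LinearMap.ker B) (hfy : f y = 1) : walsh f 0 = 0 := by
  rw [walsh_zero]
  refine sum_sgn_eq_zero f y fun x => ?_
  rw [add_comm x y, hB, LinearMap.mem_ker.1 hy, hfy, LinearMap.zero_apply]
  ring

/-- If a linear projection `π` has `f` vanishing on its image and on its kernel, then `f` is the
pairing of two complementary isotropic subspaces, and its character sum is positive. -/
lemma walsh_zero_pos_of_projection (hB : ∀ x y, f (x + y) = f x + f y + B x y)
    (π : (Fin n → ZMod 2) →ₗ[ZMod 2] (Fin n → ZMod 2))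
    (h1 : ∀ x, f (π x) = 0) (h2 : ∀ x, f (x - π x) = 0) : 0 < walsh f 0 := by
  classical
  have key : 2 ^ n * walsh f 0 =
      ∑ x : Fin n → ZMod 2, if ∀ z, B x (π z) = 0 then (2 : ℝ) ^ n else 0 := by
    have a1 : ∀ z, walsh f 0 = ∑ x, sgn (f x) * sgn (B x (π z)) := by
      intro z
      rw [walsh_zero, ← Equiv.sum_comp (Equiv.addRight (π z))]
      refine Finset.sum_congr rfl fun x _ => ?_
      rw [Equiv.coe_addRight, hB, h1, add_zero, sgn_add]
    have a2 : ∑ _z : Fin n → ZMod 2, walsh f 0 = 2 ^ n * walsh f 0 := by simp [ZMod.card]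
    rw [← a2, Finset.sum_congr rfl fun z _ => a1 z, Finset.sum_comm]
    refine Finset.sum_congr rfl fun x _ => ?_
    rw [← Finset.mul_sum, sum_sgn_additive _ fun u v => by rw [map_add, map_add], card_cube]
    split_ifs with h0
    · -- `x` is orthogonal to the image of `π`, in particular to `π x`
      have hx : f x = 0 := by
        have e := hB (x - π x) (π x)
        rw [sub_add_cancel, h2, h1, map_sub, LinearMap.sub_apply, h0 x] at e
        have hp : B (π x) (π x) = 0 := by
          have e' := hB (π x) (π x)
          have : π x + π x = π (x + x) := (map_add _ _ _).symm
          rwa [this, h1, h1, add_zero, zero_add, eq_comm] at e'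
        rw [e, hp]; simp
      simp [hx]
    · simp
  have hpos : 0 < ∑ x : Fin n → ZMod 2, if ∀ z, B x (π z) = 0 then (2 : ℝ) ^ n else 0 := by
    refine Finset.sum_pos' (fun x _ => by split_ifs <;> positivity) ⟨0, Finset.mem_univ _, ?_⟩
    simp
  rw [← key] at hpos
  exact pos_of_mul_pos_right hpos (by positivity)

end Quadratic

/-! ### The Dickson normal form -/

/-- Dickson's decomposition of a quadratic function into a sum of products of independent linear
forms plus a linear form. Splitting off `B(u, ·) B(v, ·)` with `B(u, v) = 1` puts `u` and `v` into
the radical of the polar form; as the remaining forms vanish on that radical, independence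
follows by evaluating at `u` and `v`. -/
lemma exists_hyperbolic_decomposition {V : Type*} [AddCommGroup V] [Module (ZMod 2) V]
    [FiniteDimensional (ZMod 2) V] (q : V → ZMod 2) (B : V →ₗ[ZMod 2] V →ₗ[ZMod 2] ZMod 2)
    (hB : ∀ x y, q (x + y) = q x + q y + B x y) :
    ∃ (d : ℕ) (Φ : Fin (2 * d) → (V →ₗ[ZMod 2] ZMod 2)) (l : V →ₗ[ZMod 2] ZMod 2),
      LinearIndependent (ZMod 2) Φ ∧ (∀ i, ∀ y ∈ LinearMap.ker B, Φ i y = 0) ∧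
      ∀ x, q x = ∑ i : Fin d, Φ ⟨2 * i, by omega⟩ x * Φ ⟨2 * i + 1, by omega⟩ x + l x := by
  induction hr : Module.finrank (ZMod 2) V - Module.finrank (ZMod 2) (LinearMap.ker B)
    using Nat.strong_induction_on generalizing q B with
  | _ r ih =>
  have hsymm : ∀ x y, B x y = B y x := by
    intro x y
    have h := hB x y
    rw [add_comm x y, hB, add_comm (q y) (q x)] at h
    exact (add_left_cancel h).symm
  have hq0 : q 0 = 0 := by
    have h := hB 0 0
    simpa using h
  have halt : ∀ x, B x x = 0 := by
    intro x
    have h := hB x x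
    have hx : x + x = 0 := by
      have h2 : (1 + 1 : ZMod 2) = 0 := rfl
      rw [← one_smul (ZMod 2) x, ← add_smul, h2, zero_smul]
    rwa [hx, hq0, CharTwo.add_self_eq_zero, zero_add, eq_comm] at h
  by_cases h0 : ∀ x y, B x y = 0
  · have : IsEmpty (Fin (2 * 0)) := inferInstanceAs (IsEmpty (Fin 0))
    refine ⟨0, fun i => i.elim0, AddMonoidHom.toZModLinearMap 2 (AddMonoidHom.mk' q fun x y => by
      rw [hB, h0, add_zero]), linearIndependent_empty_type, fun i => i.elim0, fun x => by simp⟩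
  · push Not at h0
    obtain ⟨u, v, huv⟩ := h0
    have huv : B u v = 1 := (zmod_two_cases _).resolve_left huv
    have hvu : B v u = 1 := hsymm v u ▸ huv
    let q' : V → ZMod 2 := fun x => q x + B u x * B v x
    let B' : V →ₗ[ZMod 2] V →ₗ[ZMod 2] ZMod 2 :=
      B + (B u).smulRight (B v) + (B v).smulRight (B u)
    have hB'a : ∀ x y, B' x y = B x y + B u x * B v y + B v x * B u y := fun x y => rfl
    have hB' : ∀ x y, q' (x + y) = q' x + q' y + B' x y := by
      intro x y
      simp only [q', hB'a, hB, map_add]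
      ring
    have hker : ∀ y ∈ LinearMap.ker B, y ∈ LinearMap.ker B' := by
      intro y hy
      rw [LinearMap.mem_ker] at hy ⊢
      ext x
      rw [hB'a, hsymm u y, hsymm v y, hy]
      simp
    have hu : u ∈ LinearMap.ker B' := by
      rw [LinearMap.mem_ker]
      ext x
      rw [hB'a, halt, hvu, zero_mul, add_zero, one_mul, CharTwo.add_self_eq_zero,
        LinearMap.zero_apply]
    have hv : v ∈ LinearMap.ker B' := by
      rw [LinearMap.mem_ker]
      ext x
      rw [hB'a, halt, huv, zero_mul, add_zero, one_mul, CharTwo.add_self_eq_zero,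
        LinearMap.zero_apply]
    have hlt : LinearMap.ker B < LinearMap.ker B' := by
      refine lt_of_le_of_ne hker fun h => ?_
      rw [← h, LinearMap.mem_ker] at hu
      rw [hu] at huv
      simp at huv
    have hfr := Submodule.finrank_lt_finrank_of_lt hlt
    have hfr' := Submodule.finrank_le (LinearMap.ker B')
    obtain ⟨d, Φ, l, hΦ, hΦk, hql⟩ := ih _ (by omega) q' B' hB' rfl
    have hspan : ∀ y ∈ LinearMap.ker B', ∀ φ ∈ Submodule.span (ZMod 2) (Set.range Φ), φ y = 0 := by
      intro y hy φ hφ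
      induction hφ using Submodule.span_induction with
      | mem φ h => obtain ⟨i, rfl⟩ := h; exact hΦk i y hy
      | zero => rfl
      | add a b _ _ ha hb => rw [LinearMap.add_apply, ha, hb, add_zero]
      | smul c a _ ha => rw [LinearMap.smul_apply, ha, smul_zero]
    refine ⟨d + 1, Fin.cons (B u) (Fin.cons (B v) Φ : Fin (2 * d + 1) → _), l, ?_, ?_, ?_⟩
    · refine linearIndependent_finCons.2 ⟨linearIndependent_finCons.2 ⟨hΦ, fun h => ?_⟩,
        fun h => ?_⟩
      · have := hspan u hu _ h
        rw [hvu] at this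
        exact one_ne_zero this
      · rw [Fin.range_cons, Submodule.mem_span_insert] at h
        obtain ⟨a, z, hz, e⟩ := h
        have := hspan v hv z hz
        have e' := congrArg (fun φ : V →ₗ[ZMod 2] ZMod 2 => φ v) e
        simp only [LinearMap.add_apply, LinearMap.smul_apply, halt, this, huv, smul_zero,
          add_zero] at e'
        exact one_ne_zero e'
    · intro i y hy
      have hy' := hker y hy
      rw [LinearMap.mem_ker] at hy
      refine Fin.cases ?_ (fun i => ?_) i
      · rw [Fin.cons_zero, hsymm, hy]; rfl
      · refine Fin.cases ?_ (fun i => ?_) i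
        · rw [Fin.cons_succ, Fin.cons_zero, hsymm, hy]; rfl
        · rw [Fin.cons_succ, Fin.cons_succ]; exact hΦk i y hy'
    · intro x
      have h := hql x
      have hq : q x = q' x + B u x * B v x := by
        simp only [q']
        rw [add_assoc, CharTwo.add_self_eq_zero, add_zero]
      rw [hq, h, Fin.sum_univ_succ]
      change _ = B u x * B v x +
        ∑ i : Fin d, Φ ⟨2 * i, by omega⟩ x * Φ ⟨2 * i + 1, by omega⟩ x + l x
      ring

/-- Linearly independent linear forms on `GF(2)^n` are the first rows of an invertible matrix. -/
lemma exists_isUnit_matrix_rows {m : ℕ} (Φ : Fin m → ((Fin n → ZMod 2) →ₗ[ZMod 2] ZMod 2))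
    (hΦ : LinearIndependent (ZMod 2) Φ) :
    ∃ (h : m ≤ n) (A : Matrix (Fin n) (Fin n) (ZMod 2)), IsUnit A ∧
      ∀ i x, A.mulVec x (Fin.castLE h i) = Φ i x := by
  have hfin : Module.finrank (ZMod 2) ((Fin n → ZMod 2) →ₗ[ZMod 2] ZMod 2) = n := by
    rw [Module.finrank_linearMap]; simp
  have hm : m ≤ n := by
    have := hΦ.fintype_card_le_finrank
    rwa [hfin, Fintype.card_fin] at this
  refine ⟨hm, ?_⟩
  obtain ⟨k, rfl⟩ := Nat.exists_eq_add_of_le hm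
  obtain ⟨Ψ, hΨ, hΨΦ⟩ : ∃ Ψ : Fin (m + k) → ((Fin (m + k) → ZMod 2) →ₗ[ZMod 2] ZMod 2),
      LinearIndependent (ZMod 2) Ψ ∧ ∀ i, Ψ (Fin.castAdd k i) = Φ i := by
    suffices ∀ j ≤ k, ∃ Ψ : Fin (m + j) → ((Fin (m + k) → ZMod 2) →ₗ[ZMod 2] ZMod 2),
        LinearIndependent (ZMod 2) Ψ ∧ ∀ i, Ψ (Fin.castAdd j i) = Φ i by
      exact this k le_rfl
    intro j
    induction j with
    | zero => exact fun _ => ⟨Φ, hΦ, fun i => rfl⟩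
    | succ j ih =>
      intro hj
      obtain ⟨Ψ, h1, h2⟩ := ih (by omega)
      obtain ⟨φ, h3⟩ := exists_linearIndependent_snoc_of_lt_finrank h1 (by rw [hfin]; omega)
      refine ⟨Fin.snoc Ψ φ, h3, fun i => ?_⟩
      rw [← h2 i]
      exact Fin.snoc_castSucc (α := fun _ => (Fin (m + k) → ZMod 2) →ₗ[ZMod 2] ZMod 2) φ Ψ
        (Fin.castAdd j i)
  let T : ((Fin (m + k) → ZMod 2) →ₗ[ZMod 2] ZMod 2) →ₗ[ZMod 2] (Fin (m + k) → ZMod 2) :=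
    { toFun := fun φ j => φ (Pi.single j 1)
      map_add' := fun _ _ => rfl
      map_smul' := fun _ _ => rfl }
  have hT : ∀ φ x, ∑ j, T φ j * x j = φ x := by
    intro φ x
    rw [LinearMap.pi_apply_eq_sum_univ φ x]
    refine Finset.sum_congr rfl fun j _ => ?_
    have hs : (Pi.single j 1 : Fin (m + k) → ZMod 2) = fun i => if j = i then 1 else 0 := by
      ext i
      simp [Pi.single_apply, eq_comm]
    change φ (Pi.single j 1) * x j = x j * φ _
    rw [hs, mul_comm]
  refine ⟨Matrix.of fun i => T (Ψ i), ?_, fun i x => ?_⟩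
  · rw [← Matrix.linearIndependent_rows_iff_isUnit]
    refine hΨ.map' T (LinearMap.ker_eq_bot'.2 fun φ hφ => ?_)
    refine LinearMap.ext fun x => ?_
    rw [← hT, hφ]
    simp
  · rw [← hΨΦ i, ← hT]
    rfl

lemma sum_affine_change {A : Matrix (Fin n) (Fin n) (ZMod 2)} (hA : IsUnit A)
    (b : Fin n → ZMod 2) (F : (Fin n → ZMod 2) → ℝ) : ∑ x, F (A.mulVec x + b) = ∑ x, F x := by
  refine Function.Bijective.sum_comp (e := fun x => A.mulVec x + b) ?_ F
  refine Function.Injective.bijective_of_finite fun x y h => ?_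
  exact Matrix.mulVec_injective_iff_isUnit.2 hA (add_right_cancel h)

lemma hyperbolicSum_add_single {d : ℕ} (h : 2 * d ≤ n) (x : Fin n → ZMod 2) (j : Fin n)
    (hj : 2 * d ≤ j) (a : ZMod 2) :
    hyperbolicSum h (x + Pi.single j a) = hyperbolicSum h x := by
  refine Finset.sum_congr rfl fun i _ => ?_
  have h1 : (⟨2 * i, by omega⟩ : Fin n) ≠ j := fun e => by
    have := congrArg Fin.val e; simp only at this; omega
  have h2 : (⟨2 * i + 1, by omega⟩ : Fin n) ≠ j := fun e => by
    have := congrArg Fin.val e; simp only at this; omega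
  simp [Pi.single_eq_of_ne h1, Pi.single_eq_of_ne h2]

/-- Each hyperbolic plane halves the character sum. -/
lemma sum_sgn_hyperbolicSum {d : ℕ} (h : 2 * d ≤ n) :
    2 ^ d * ∑ x, sgn (hyperbolicSum h x) = (2 : ℝ) ^ n := by
  induction d with
  | zero => simp [hyperbolicSum, ZMod.card]
  | succ d ih =>
    have hd : 2 * d ≤ n := by omega
    set p : Fin n := ⟨2 * d, by omega⟩
    set q : Fin n := ⟨2 * d + 1, by omega⟩
    have hpq : q ≠ p := fun e => by
      have := congrArg Fin.val e; simp [p, q] at this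
    have hsucc : ∀ x, hyperbolicSum h x = hyperbolicSum hd x + x p * x q :=
      fun x => Fin.sum_univ_castSucc _
    -- averaging over the translation along `x_{2d}`
    have h1 : ∑ x, sgn (hyperbolicSum h x) =
        ∑ x, sgn (hyperbolicSum hd x) * sgn (x p * x q + x q) := by
      rw [← Equiv.sum_comp (Equiv.addRight (Pi.single p 1 : Fin n → ZMod 2))]
      refine Finset.sum_congr rfl fun x _ => ?_
      rw [Equiv.coe_addRight, hsucc, hyperbolicSum_add_single hd x p le_rfl, sgn_add]
      simp [Pi.single_eq_of_ne hpq, add_mul]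
    have h2 : ∑ x, sgn (hyperbolicSum hd x + x q) = 0 := by
      refine sum_sgn_eq_zero _ (Pi.single q 1) fun x => ?_
      rw [hyperbolicSum_add_single hd x q (Nat.le_succ _)]
      simp [add_assoc]
    have h3 : ∑ x, sgn (hyperbolicSum h x) + ∑ x, sgn (hyperbolicSum h x) =
        ∑ x, sgn (hyperbolicSum hd x) + ∑ x, sgn (hyperbolicSum hd x + x q) := by
      nth_rewrite 2 [h1]
      rw [← Finset.sum_add_distrib, ← Finset.sum_add_distrib]
      refine Finset.sum_congr rfl fun x _ => ?_
      rw [hsucc, sgn_add, sgn_add]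
      rcases zmod_two_cases (x p) with e | e <;> rcases zmod_two_cases (x q) with e' | e' <;>
        simp [sgn_add, e, e']
    rw [h2, add_zero] at h3
    rw [← ih hd, ← h3]
    ring

/-- The Dickson rank `d` is visible in the Walsh spectrum: some value has modulus `2^{n-d}`. -/
lemma IsDicksonRank.exists_abs_walsh {f : BoolFun n} {d : ℕ} (h : f.IsDicksonRank d) :
    ∃ w, 2 ^ d * |walsh f w| = (2 : ℝ) ^ n := by
  have habs : ∀ a (s : ℝ), |sgn a * s| = |s| := fun a s => by
    rcases sgn_eq_one_or a with h | h <;> simp [h]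
  rcases h with ⟨-, hd, A, b, hA, hf⟩ | ⟨-, hd, c, A, b, hA, hf⟩
  · refine ⟨fun i => A ⟨2 * d, hd⟩ i, ?_⟩
    have h1 := sum_affine_change hA b fun y => sgn (hyperbolicSum (Nat.le_of_succ_le hd) y)
    have h2 : walsh f (fun i => A ⟨2 * d, hd⟩ i) = sgn (b ⟨2 * d, hd⟩) *
        ∑ x, sgn (hyperbolicSum (Nat.le_of_succ_le hd) x) := by
      rw [← h1, walsh_eq_sum_sgn, Finset.mul_sum]
      refine Finset.sum_congr rfl fun x _ => ?_
      have h3 : (A.mulVec x + b) ⟨2 * d, hd⟩ = ∑ i, A ⟨2 * d, hd⟩ i * x i + b ⟨2 * d, hd⟩ := rfl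
      rw [← sgn_add, hf]
      simp only [h3]
      congr 1
      linear_combination CharTwo.add_self_eq_zero (∑ i, A ⟨2 * d, hd⟩ i * x i)
    have h4 := sum_sgn_hyperbolicSum (Nat.le_of_succ_le hd)
    rw [h2, habs, ← h4, abs_of_pos]
    by_contra h5
    nlinarith [show (0 : ℝ) < 2 ^ d by positivity, show (0 : ℝ) < 2 ^ n by positivity]
  · refine ⟨0, ?_⟩
    have h1 := sum_affine_change hA b fun y => sgn (hyperbolicSum hd y)
    have h4 := sum_sgn_hyperbolicSum hd
    simp only [walsh_zero, hf, sgn_add]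
    rw [← Finset.sum_mul, h1, mul_comm _ (sgn c), habs, ← h4, abs_of_pos]
    by_contra h5
    nlinarith [show (0 : ℝ) < 2 ^ d by positivity, show (0 : ℝ) < 2 ^ n by positivity]

lemma IsDicksonRank.two_mul_add {f : BoolFun n} {d v : ℕ} (h : f.IsDicksonRank d)
    (hv : f.IsVPlateaued v) : 2 * d + v = n := by
  obtain ⟨w, hw⟩ := h.exists_abs_walsh
  have h0 : walsh f w ≠ 0 := by
    intro h0
    rw [h0, abs_zero, mul_zero] at hw
    exact absurd hw.symm (by positivity)
  rw [hv.abs_walsh h0, ← Real.rpow_natCast, ← Real.rpow_natCast,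
    ← Real.rpow_add (by norm_num)] at hw
  have h1 := (Real.rpow_right_inj (by norm_num) (by norm_num)).1 hw
  have h2 : ((2 * d + v : ℕ) : ℝ) = n := by push_cast; linarith
  exact_mod_cast h2

lemma sum_fin_two_mul {M : Type*} [AddCommMonoid M] {d : ℕ} (g : Fin (2 * d) → M) :
    ∑ j, g j = ∑ i : Fin d, (g ⟨2 * i, by omega⟩ + g ⟨2 * i + 1, by omega⟩) := by
  rw [← (finProdFinEquiv.trans (finCongr (mul_comm d 2))).sum_comp, Fintype.sum_prod_type]
  refine Finset.sum_congr rfl fun i _ => ?_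
  rw [Fin.sum_univ_two]
  congr 2
  · ext; simp
  · ext; simp [add_comm]

/-- Dickson's theorem. A linear part lying in the span of the forms of the hyperbolic part is
absorbed by a translation; otherwise it serves as a further coordinate. -/
lemma exists_isDicksonRank {f : BoolFun n}
    {B : (Fin n → ZMod 2) →ₗ[ZMod 2] (Fin n → ZMod 2) →ₗ[ZMod 2] ZMod 2}
    (hB : ∀ x y, f (x + y) = f x + f y + B x y) : ∃ d, f.IsDicksonRank d := by
  obtain ⟨d, Φ, l, hΦ, -, hf⟩ := exists_hyperbolic_decomposition f B hB
  refine ⟨d, ?_⟩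
  by_cases hl : l ∈ Submodule.span (ZMod 2) (Set.range Φ)
  · obtain ⟨c, rfl⟩ := (Submodule.mem_span_range_iff_exists_fun _).1 hl
    obtain ⟨hd, A, hA, hAΦ⟩ := exists_isUnit_matrix_rows Φ hΦ
    -- `(φ + c')(ψ + c) = φψ + cφ + c'ψ + cc'`: the translation exchanges paired coefficients
    let c' : ℕ → ZMod 2 := fun j => if h : j < 2 * d then c ⟨j, h⟩ else 0
    let b : Fin n → ZMod 2 := fun j => if (j : ℕ) % 2 = 0 then c' (j + 1) else c' (j - 1)
    let k : ZMod 2 := ∑ i : Fin d, c ⟨2 * i, by omega⟩ * c ⟨2 * i + 1, by omega⟩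
    have hfA : ∀ x, f x = hyperbolicSum hd (A.mulVec x + b) + k := by
      intro x
      have hb0 : ∀ i : Fin d, b ⟨2 * i, by omega⟩ = c ⟨2 * i + 1, by omega⟩ := by
        intro i
        have : 2 * (i : ℕ) + 1 < 2 * d := by omega
        simp [b, c', this]
      have hb1 : ∀ i : Fin d, b ⟨2 * i + 1, by omega⟩ = c ⟨2 * i, by omega⟩ := by
        intro i
        simp [b, c', Nat.add_mod]
      have e : hyperbolicSum hd (A.mulVec x + b) = f x + k := by
        rw [hf, LinearMap.sum_apply, sum_fin_two_mul, ← Finset.sum_add_distrib,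
          ← Finset.sum_add_distrib]
        refine Finset.sum_congr rfl fun i _ => ?_
        have e0 : A.mulVec x ⟨2 * i, by omega⟩ = Φ ⟨2 * i, by omega⟩ x :=
          hAΦ ⟨2 * i, by omega⟩ x
        have e1 : A.mulVec x ⟨2 * i + 1, by omega⟩ = Φ ⟨2 * i + 1, by omega⟩ x :=
          hAΦ ⟨2 * i + 1, by omega⟩ x
        rw [Pi.add_apply, Pi.add_apply, e0, e1, hb0, hb1]
        simp only [LinearMap.smul_apply, smul_eq_mul]
        ring
      rw [e, add_assoc, CharTwo.add_self_eq_zero, add_zero]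
    refine Or.inr ⟨?_, hd, k, A, b, hA, hfA⟩
    rw [isBalanced_iff, walsh_zero]
    have h1 := sum_affine_change hA b fun y => sgn (hyperbolicSum hd y)
    have h4 := sum_sgn_hyperbolicSum hd
    simp only [hfA, sgn_add]
    rw [← Finset.sum_mul, h1]
    intro h0
    rcases mul_eq_zero.1 h0 with h0 | h0
    · rw [h0, mul_zero] at h4
      exact absurd h4.symm (by positivity)
    · rcases sgn_eq_one_or k with h5 | h5 <;> rw [h5] at h0 <;> norm_num at h0
  · obtain ⟨hd, A, hA, hAΦ⟩ := exists_isUnit_matrix_rows (Fin.snoc Φ l : Fin (2 * d + 1) → _)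
      (linearIndependent_finSnoc.2 ⟨hΦ, hl⟩)
    have hA0 : ∀ x (i : Fin (2 * d)), A.mulVec x ⟨i, by omega⟩ = Φ i x := by
      intro x i
      have := hAΦ i.castSucc x
      rwa [Fin.snoc_castSucc] at this
    have hA1 : ∀ x, A.mulVec x ⟨2 * d, hd⟩ = l x := by
      intro x
      have := hAΦ (Fin.last _) x
      rwa [Fin.snoc_last] at this
    have hfA : ∀ x, f x = hyperbolicSum (Nat.le_of_succ_le hd) (A.mulVec x + 0) +
        (A.mulVec x + 0) ⟨2 * d, hd⟩ := by
      intro x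
      rw [add_zero, hA1, hf]
      congr 1
      refine Finset.sum_congr rfl fun i _ => ?_
      rw [← hA0 x, ← hA0 x]
    refine Or.inl ⟨?_, hd, A, 0, hA, hfA⟩
    rw [isBalanced_iff, walsh_zero]
    simp only [hfA]
    rw [sum_affine_change hA 0 fun y =>
      sgn (hyperbolicSum (Nat.le_of_succ_le hd) y + y ⟨2 * d, hd⟩)]
    refine sum_sgn_eq_zero _ (Pi.single ⟨2 * d, hd⟩ 1) fun x => ?_
    rw [hyperbolicSum_add_single _ x _ le_rfl]
    simp [add_assoc]

/-! ### Cyclic sequences and the radical of `(0,t)_n` -/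

/-- The `n`-periodic sequence on `ℕ` which extends `x : GF(2)^n`. -/
def cyc [NeZero n] (x : Fin n → ZMod 2) (i : ℕ) : ZMod 2 := x (Fin.ofNat n i)

lemma sum_range_add_of_periodic {P : ℕ → ZMod 2} (hP : Function.Periodic P n) (c : ℕ) :
    ∑ i ∈ Finset.range n, P (i + c) = ∑ i ∈ Finset.range n, P i := by
  induction c with
  | zero => rfl
  | succ c ih =>
    have h1 := Finset.sum_range_succ (fun i => P (i + c)) n
    have h2 := Finset.sum_range_succ' (fun i => P (i + c)) n
    have h3 : P (n + c) = P (0 + c) := by rw [zero_add, add_comm, hP]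
    rw [h2, h3] at h1
    rw [← ih, ← add_right_cancel h1]
    refine Finset.sum_congr rfl fun i _ => ?_
    rw [add_right_comm, add_assoc, add_comm c 1, ← add_assoc, add_right_comm]

section Cyc

variable [NeZero n]

lemma cyc_of_lt (x : Fin n → ZMod 2) {i : ℕ} (hi : i < n) : cyc x i = x ⟨i, hi⟩ := by
  rw [cyc]
  congr 1
  ext
  simp [Nat.mod_eq_of_lt hi]

lemma cyc_periodic (x : Fin n → ZMod 2) : Function.Periodic (cyc x) n := fun i => by
  simp [cyc, Fin.ofNat]

lemma cyc_congr (x : Fin n → ZMod 2) {i j : ℕ} (h : i % n = j % n) : cyc x i = cyc x j := by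
  rw [← (cyc_periodic x).map_mod_nat i, h, (cyc_periodic x).map_mod_nat]

lemma mrs_eq_sum_range (t : ℕ) (x : Fin n → ZMod 2) :
    mrs n t x = ∑ i ∈ Finset.range n, cyc x i * cyc x (i + t) := by
  rw [Finset.sum_range]
  refine Finset.sum_congr rfl fun i _ => ?_
  rw [cyc_of_lt x i.2]
  rfl

/-- The polar form of `(0,t)_n`. -/
def mrsPolar (n t : ℕ) [NeZero n] :
    (Fin n → ZMod 2) →ₗ[ZMod 2] (Fin n → ZMod 2) →ₗ[ZMod 2] ZMod 2 :=
  LinearMap.mk₂ (ZMod 2)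
    (fun x y => ∑ i ∈ Finset.range n, (cyc x i * cyc y (i + t) + cyc y i * cyc x (i + t)))
    (fun x y z => by
      rw [← Finset.sum_add_distrib]
      exact Finset.sum_congr rfl fun i _ => by simp only [cyc, Pi.add_apply]; ring)
    (fun c x y => by
      rw [smul_eq_mul, Finset.mul_sum]
      exact Finset.sum_congr rfl fun i _ => by
        simp only [cyc, Pi.smul_apply, smul_eq_mul]; ring)
    (fun x y z => by
      rw [← Finset.sum_add_distrib]
      exact Finset.sum_congr rfl fun i _ => by simp only [cyc, Pi.add_apply]; ring)
    (fun c x y => by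
      rw [smul_eq_mul, Finset.mul_sum]
      exact Finset.sum_congr rfl fun i _ => by
        simp only [cyc, Pi.smul_apply, smul_eq_mul]; ring)

lemma mrs_add (t : ℕ) (x y : Fin n → ZMod 2) :
    mrs n t (x + y) = mrs n t x + mrs n t y + mrsPolar n t x y := by
  simp only [mrs_eq_sum_range, mrsPolar, LinearMap.mk₂_apply]
  rw [← Finset.sum_add_distrib, ← Finset.sum_add_distrib]
  exact Finset.sum_congr rfl fun i _ => by simp only [cyc, Pi.add_apply]; ring

lemma mrsPolar_apply {t : ℕ} (ht : t ≤ n) (x y : Fin n → ZMod 2) :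
    mrsPolar n t x y =
      ∑ i ∈ Finset.range n, cyc x i * (cyc y (i + t) + cyc y (i + (n - t))) := by
  have h := sum_range_add_of_periodic (P := fun i => cyc y i * cyc x (i + t)) (n := n)
    (fun i => by
      simp only
      rw [add_right_comm, cyc_periodic x, cyc_periodic y]) (n - t)
  simp only [mrsPolar, LinearMap.mk₂_apply, mul_add]
  rw [Finset.sum_add_distrib, Finset.sum_add_distrib, ← h]
  congr 1
  refine Finset.sum_congr rfl fun i _ => ?_
  rw [add_assoc, Nat.sub_add_cancel ht, cyc_periodic x, mul_comm]

lemma mem_ker_mrsPolar {t : ℕ} (ht : t ≤ n) (y : Fin n → ZMod 2) :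
    y ∈ LinearMap.ker (mrsPolar n t) ↔ Function.Periodic (cyc y) (2 * t) := by
  rw [LinearMap.mem_ker]
  have hsymm : ∀ x, mrsPolar n t y x = mrsPolar n t x y := fun x => by
    simp only [mrsPolar, LinearMap.mk₂_apply]
    exact Finset.sum_congr rfl fun i _ => add_comm _ _
  constructor
  · intro h i
    have h1 : ∀ j : Fin n, cyc y (j + t) = cyc y (j + (n - t)) := by
      intro j
      have h2 : mrsPolar n t (Pi.single j 1) y = 0 := by rw [← hsymm, h]; rfl
      rw [mrsPolar_apply ht, Finset.sum_range, Finset.sum_eq_single j] at h2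
      · rw [cyc_of_lt _ j.2, Fin.eta, Pi.single_eq_same, one_mul] at h2
        exact CharTwo.add_eq_zero.1 h2
      · intro k _ hk
        rw [cyc_of_lt _ k.2, Fin.eta, Pi.single_eq_of_ne hk, zero_mul]
      · simp
    have h3 := h1 (Fin.ofNat n (i + t))
    have h4 : ∀ c, cyc y ((Fin.ofNat n (i + t) : Fin n) + c) = cyc y (i + t + c) :=
      fun c => cyc_congr y (by simp)
    rw [h4, h4, add_assoc i t (n - t), Nat.add_sub_cancel' ht, cyc_periodic y] at h3
    rw [← h3]
    congr 1
    ring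
  · intro h
    refine LinearMap.ext fun x => ?_
    rw [hsymm, mrsPolar_apply ht]
    refine Finset.sum_eq_zero fun i _ => ?_
    have h1 : cyc y (i + (n - t)) = cyc y (i + t) := by
      rw [← h (i + (n - t)), ← cyc_periodic y (i + t)]
      congr 1
      omega
    rw [h1, CharTwo.add_self_eq_zero, mul_zero]

/-- A sequence with periods `n` and `2t` has period `gcd(n, 2t)`, and is determined by its first
`gcd(n, 2t)` terms. -/
lemma card_ker_mrsPolar {t : ℕ} (ht : 1 ≤ t) (hn : 2 * t + 1 ≤ n) :
    Nat.card (LinearMap.ker (mrsPolar n t)) = 2 ^ n.gcd (2 * t) := by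
  set g := n.gcd (2 * t) with hg
  have hg0 : 0 < g := Nat.gcd_pos_of_pos_right _ (by omega)
  have hgt : g ≤ 2 * t := Nat.gcd_le_right _ (by omega)
  have hgn : g < n := by omega
  have hper : ∀ y ∈ LinearMap.ker (mrsPolar n t), Function.Periodic (cyc y) g := by
    intro y hy i
    rw [mem_ker_mrsPolar (by omega)] at hy
    obtain ⟨m, -, hm⟩ := Nat.exists_mul_mod_eq_gcd (k := n) (n := 2 * t)
      (by rw [Nat.gcd_comm]; exact hgn)
    rw [← (hy.nat_mul m) i]
    refine cyc_congr y ?_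
    rw [Nat.gcd_comm, ← hg] at hm
    rw [← hm, Nat.add_mod_mod, mul_comm, Nat.cast_id]
  have e : LinearMap.ker (mrsPolar n t) ≃ (Fin g → ZMod 2) :=
    { toFun := fun y j => y.1 ⟨j, by omega⟩
      invFun := fun z => ⟨fun i => z ⟨i % g, Nat.mod_lt _ hg0⟩, by
        rw [mem_ker_mrsPolar (by omega)]
        intro i
        have h1 : (i + 2 * t) % n % g = i % n % g := by
          rw [Nat.mod_mod_of_dvd _ (Nat.gcd_dvd_left _ _),
            Nat.mod_mod_of_dvd _ (Nat.gcd_dvd_left _ _), Nat.add_mod,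
            Nat.mod_eq_zero_of_dvd (Nat.gcd_dvd_right n (2 * t)), add_zero, Nat.mod_mod]
        simp [cyc, h1]⟩
      left_inv := by
        intro y
        ext i
        have h1 := (hper y.1 y.2).map_mod_nat i
        rw [cyc_of_lt _ i.2, cyc_of_lt _ ((Nat.mod_lt _ hg0).trans hgn)] at h1
        exact h1
      right_inv := by
        intro z
        ext j
        simp [Nat.mod_eq_of_lt j.2] }
  rw [Nat.card_congr e, Nat.card_eq_fintype_card, card_cube]

lemma isVPlateaued_mrs {t : ℕ} (ht : 1 ≤ t) (hn : 2 * t + 1 ≤ n) :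
    (mrs n t).IsVPlateaued (n.gcd (2 * t)) :=
  isVPlateaued_of_card_ker (mrs_add t) (card_ker_mrsPolar ht hn)

end Cyc

/-! ### The balancedness criterion -/

/-- When `n` is a multiple of `2^{a+1}`, with `2^a` the largest power of two dividing `t`, the
`a`-th binary digit of the index distinguishes the two factors of every monomial. -/
lemma digit_shift {n t a s : ℕ} (hts : t = 2 ^ a * s) (hs : s % 2 = 1) (hn : 2 ^ (a + 1) ∣ n)
    (i : ℕ) : (i + t) % n / 2 ^ a % 2 = (i / 2 ^ a + 1) % 2 := by
  rw [← Nat.mod_mul_right_div_self, ← pow_succ, Nat.mod_mod_of_dvd _ hn, pow_succ,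
    Nat.mod_mul_right_div_self, hts, Nat.add_mul_div_left _ _ (by positivity)]
  omega

lemma walsh_mrs_zero_pos {t : ℕ} [NeZero n] (ht : 1 ≤ t)
    (h : 2 ^ (padicValNat 2 t + 1) ∣ n) : 0 < walsh (mrs n t) 0 := by
  set a := padicValNat 2 t with ha
  obtain ⟨s, hs⟩ : 2 ^ a ∣ t := pow_padicValNat_dvd
  have hs1 : s % 2 = 1 := by
    by_contra h0
    refine pow_succ_padicValNat_not_dvd (p := 2) (n := t) (by omega) ?_
    rw [← ha, pow_succ, hs]
    exact mul_dvd_mul_left _ (by omega)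
  let π : (Fin n → ZMod 2) →ₗ[ZMod 2] (Fin n → ZMod 2) :=
    { toFun := fun x i => if (i : ℕ) / 2 ^ a % 2 = 0 then x i else 0
      map_add' := fun x y => by ext i; simp only [Pi.add_apply]; split_ifs <;> simp
      map_smul' := fun c x => by ext i; simp }
  have hπ : ∀ x i, π x i = if (i : ℕ) / 2 ^ a % 2 = 0 then x i else 0 := fun _ _ => rfl
  refine walsh_zero_pos_of_projection (mrs_add t) π (fun x => ?_) fun x => ?_
  all_goals
    refine Finset.sum_eq_zero fun i _ => ?_
    have hd := digit_shift hs hs1 h i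
    rcases Nat.mod_two_eq_zero_or_one ((i : ℕ) / 2 ^ a) with h0 | h0
    · have h1 : ((i : ℕ) + t) % n / 2 ^ a % 2 = 1 := by omega
      simp [hπ, h0, h1]
    · have h1 : ((i : ℕ) + t) % n / 2 ^ a % 2 = 0 := by omega
      simp [hπ, h0, h1]

lemma sum_range_mul_ite_dvd (p m : ℕ) (hp : 0 < p) :
    ∑ i ∈ Finset.range (p * m), (if p ∣ i then (1 : ZMod 2) else 0) = m := by
  induction m with
  | zero => simp
  | succ m ih =>
    rw [mul_add_one, Finset.sum_range_add, ih, Finset.sum_eq_single 0]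
    · simp
    · intro j hj hj0
      rw [if_neg]
      rw [Nat.dvd_add_right (dvd_mul_right p m)]
      exact Nat.not_dvd_of_pos_of_lt (Nat.pos_of_ne_zero hj0) (Finset.mem_range.1 hj)
    · simp [hp.ne']

/-- Let `p` be the largest power of two dividing `n`. If `p` divides `t`, the indicator of the
multiples of `p` lies in the radical, and `(0,t)_n` takes there the odd value `n / p`. -/
lemma walsh_mrs_zero_eq_zero {t : ℕ} [NeZero n] (htn : t ≤ n)
    (h : ¬ 2 ^ (padicValNat 2 t + 1) ∣ n) : walsh (mrs n t) 0 = 0 := by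
  have hn0 : n ≠ 0 := NeZero.ne n
  obtain ⟨p, m, hp, hnp, hm, hpt⟩ : ∃ p m, 0 < p ∧ n = p * m ∧ m % 2 = 1 ∧ p ∣ t := by
    obtain ⟨m, hm⟩ : 2 ^ padicValNat 2 n ∣ n := pow_padicValNat_dvd
    refine ⟨2 ^ padicValNat 2 n, m, by positivity, hm, ?_, ?_⟩
    · by_contra h0
      refine pow_succ_padicValNat_not_dvd (p := 2) hn0 ?_
      rw [pow_succ]
      nth_rewrite 2 [hm]
      exact mul_dvd_mul_left _ (by omega)
    · refine (pow_dvd_pow 2 ?_).trans (pow_padicValNat_dvd (p := 2) (n := t))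
      by_contra h0
      exact h ((pow_dvd_pow 2 (by omega)).trans (pow_padicValNat_dvd (p := 2) (n := n)))
  have hpn : p ∣ n := ⟨m, hnp⟩
  set y : Fin n → ZMod 2 := fun i => if p ∣ (i : ℕ) then 1 else 0
  have hy : ∀ i, cyc y i = if p ∣ i then 1 else 0 := by
    intro i
    simp [cyc, y, Nat.dvd_mod_iff hpn]
  refine walsh_zero_eq_zero_of_mem_ker (mrs_add t) (y := y) ?_ ?_
  · rw [mem_ker_mrsPolar htn]
    intro i
    rw [hy, hy]
    simp [Nat.dvd_add_left (hpt.mul_left 2)]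
  · rw [mrs_eq_sum_range]
    have h1 : ∀ i, cyc y i * cyc y (i + t) = if p ∣ i then 1 else 0 := by
      intro i
      rw [hy, hy]
      simp [Nat.dvd_add_left hpt]
    simp only [h1]
    rw [hnp, sum_range_mul_ite_dvd p m hp]
    rw [← ZMod.natCast_mod, hm, Nat.cast_one]

lemma not_isBalanced_mrs_iff {t : ℕ} (ht : 1 ≤ t) (htn : t ≤ n) :
    ¬ (mrs n t).IsBalanced ↔ 2 ^ (padicValNat 2 t + 1) ∣ n := by
  have : NeZero n := ⟨by omega⟩
  rw [isBalanced_iff]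
  by_cases h : 2 ^ (padicValNat 2 t + 1) ∣ n
  · simp [h, (walsh_mrs_zero_pos ht h).ne']
  · simp [h, walsh_mrs_zero_eq_zero htn h]

lemma gcd_two_mul_of_not_dvd {n t : ℕ} (h : ¬ 2 ^ (padicValNat 2 t + 1) ∣ n) :
    n.gcd (2 * t) = n.gcd t := by
  refine Nat.dvd_antisymm (Nat.dvd_gcd (Nat.gcd_dvd_left _ _) ?_)
    (Nat.gcd_dvd_gcd_of_dvd_right _ (dvd_mul_left t 2))
  obtain ⟨r, hr⟩ := Nat.gcd_dvd_right n (2 * t)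
  rcases Nat.even_or_odd' r with ⟨c, rfl | hc⟩
  · exact ⟨c, by linarith⟩
  · refine absurd ?_ h
    have h1 : 2 ^ (padicValNat 2 t + 1) ∣ n.gcd (2 * t) * r := by
      rw [← hr, pow_succ']
      exact mul_dvd_mul_left 2 pow_padicValNat_dvd
    have h2 : Nat.Coprime (2 ^ (padicValNat 2 t + 1)) r :=
      Nat.Coprime.pow_left _ ((Nat.coprime_two_left).2 ⟨c, hc⟩)
    exact (h2.dvd_of_dvd_mul_right h1).trans (Nat.gcd_dvd_left _ _)

lemma gcd_two_mul_of_dvd {n t : ℕ} (h : 2 ^ (padicValNat 2 t + 1) ∣ n) (ht : 1 ≤ t) :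
    n.gcd (2 * t) = 2 * n.gcd t := by
  refine Nat.dvd_antisymm ?_ (Nat.dvd_gcd ?_ (mul_dvd_mul_left 2 (Nat.gcd_dvd_right _ _)))
  · rw [← Nat.gcd_mul_left]
    exact Nat.gcd_dvd_gcd_of_dvd_left _ (dvd_mul_left n 2)
  · obtain ⟨r, hr⟩ := Nat.gcd_dvd_left n t
    rcases Nat.even_or_odd' r with ⟨c, rfl | hc⟩
    · exact ⟨c, by linarith⟩
    · have h2 : Nat.Coprime (2 ^ (padicValNat 2 t + 1)) r :=
        Nat.Coprime.pow_left _ ((Nat.coprime_two_left).2 ⟨c, hc⟩)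
      have h1 := (h2.dvd_of_dvd_mul_right (hr ▸ h)).trans (Nat.gcd_dvd_right _ _)
      exact absurd h1 (pow_succ_padicValNat_not_dvd (by omega))

end BoolFun

theorem mainTheorem7 (n t : ℕ) (ht : 1 ≤ t) (hn : 2 * t + 1 ≤ n) :
    -- the balancedness criterion
    (¬ (BoolFun.mrs n t).IsBalanced ↔ n ≡ 0 [MOD 2 ^ (padicValNat 2 t + 1)]) ∧
    -- the `v`-value and the Dickson rank exist and are unique
    (∀ v : ℕ, (BoolFun.mrs n t).IsVPlateaued v ↔ v = n.gcd (2 * t)) ∧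
    (∃! d : ℕ, (BoolFun.mrs n t).IsDicksonRank d) ∧
    -- the balanced case
    ((BoolFun.mrs n t).IsBalanced →
      n.gcd (2 * t) = n.gcd t ∧
      (BoolFun.mrs n t).wt = 2 ^ (n - 1) ∧
      ((BoolFun.mrs n t).nonlinearity : ℝ) =
        2 ^ (n - 1) - (2 : ℝ) ^ (((n : ℝ) + n.gcd t) / 2 - 1) ∧
      ∀ d : ℕ, (BoolFun.mrs n t).IsDicksonRank d → 2 * d + n.gcd t = n) ∧
    -- the unbalanced case
    (¬ (BoolFun.mrs n t).IsBalanced →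
      n.gcd (2 * t) = 2 * n.gcd t ∧
      ((BoolFun.mrs n t).wt : ℝ) =
        2 ^ (n - 1) - (2 : ℝ) ^ ((n : ℝ) / 2 + n.gcd t - 1) ∧
      ((BoolFun.mrs n t).nonlinearity : ℝ) =
        2 ^ (n - 1) - (2 : ℝ) ^ ((n : ℝ) / 2 + n.gcd t - 1) ∧
      ∀ d : ℕ, (BoolFun.mrs n t).IsDicksonRank d → 2 * d + 2 * n.gcd t = n) := by
  have : NeZero n := ⟨by omega⟩
  have hcrit := BoolFun.not_isBalanced_mrs_iff (n := n) ht (by omega)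
  have hv := BoolFun.isVPlateaued_mrs (n := n) ht hn
  have hd : ∀ d : ℕ, (BoolFun.mrs n t).IsDicksonRank d → 2 * d + n.gcd (2 * t) = n :=
    fun d h => h.two_mul_add hv
  have hnl := hv.nonlinearity_eq (by omega)
  have hwt := BoolFun.walsh_zero_eq_wt (BoolFun.mrs n t)
  have e2 : (2 : ℝ) ^ n = 2 * 2 ^ (n - 1) := by
    rw [← pow_succ', Nat.sub_add_cancel (by omega)]
  refine ⟨hcrit.trans Nat.modEq_zero_iff_dvd.symm, fun v => ⟨fun h => h.unique hv, fun h => h ▸ hv⟩,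
    ?_, fun hb => ?_, fun hb => ?_⟩
  · obtain ⟨d, h⟩ := BoolFun.exists_isDicksonRank (BoolFun.mrs_add (n := n) t)
    refine ⟨d, h, fun d' h' => ?_⟩
    have h1 := hd d h
    have h2 := hd d' h'
    omega
  · have hg := BoolFun.gcd_two_mul_of_not_dvd (n := n) (t := t) fun h => hcrit.2 h hb
    rw [hg] at hd hnl
    refine ⟨hg, ?_, hnl, hd⟩
    rw [(BoolFun.isBalanced_iff _).1 hb, e2] at hwt
    have : ((BoolFun.mrs n t).wt : ℝ) = 2 ^ (n - 1) := by linarith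
    exact_mod_cast this
  · have hg := BoolFun.gcd_two_mul_of_dvd (hcrit.1 hb) ht
    have hpos := BoolFun.walsh_mrs_zero_pos ht (hcrit.1 hb)
    have habs := hv.abs_walsh hpos.ne'
    have he : ((n : ℝ) + (n.gcd (2 * t) : ℕ)) / 2 = (n : ℝ) / 2 + n.gcd t := by
      rw [hg]; push_cast; ring
    rw [abs_of_pos hpos, he] at habs
    rw [he] at hnl
    rw [hg] at hd
    refine ⟨hg, ?_, hnl, hd⟩
    rw [Real.rpow_sub (by norm_num), Real.rpow_one]
    rw [habs, e2] at hwt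
    linarith
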